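/- For $d,r\in\mathbb N=\{1,2,\dots\}$ and a set $D\subset\mathbb R^d$ that is either the closed cube $[0,1]^d$ or an open set of Lebesgue measure $1$, let $$\mathcal C^r(D)=\{f\in C^r(D):\ |D^\beta f(x)|\le 1\ \text{ for all } x\in D \text{ and all } \beta\in\mathbb N_0^d \text{ with } |\beta|_1\le r\},$$ where $\mathbb N_0=\{0,1,2,\dots\}$ and $|\beta|_1=\beta_1+\dots+\beta_d$, and let $S_D(f)=\int_D f(x)\,dx$. An algorithm $A_n$ using $n$ function values has the form $A_n(f)=\varphi(f(x_1),\dots,f(x_n))$ with an arbitrary map $\varphi:\mathbb R^n\to\mathbb R$ and sample points $x_i\in D$ that may be chosen adaptively, i.e. $x_i$ may depend on $f(x_1),\dots,f(x_{i-1})$. Let $$e_n(\mathcal C^r(D))=\inf_{A_n}\ \sup_{f\in\mathcal C^r(D)}|S_D(f)-A_n(f)|,\qquad n(\varepsilon,D,r)=\min\{n\in\mathbb N_0:\ e_n(\mathcal C^r(D))\le\varepsilon\},$$ with $\min\emptyset=\infty$, and write $n(\varepsilon,d,r)=n(\varepsilon,[0,1]^d,r)$. Theorem. For every $r\in\mathbb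 N$ there are constants $c_{r,1},c_{r,2}>0$, depending only on $r$, such that for all $d\in\mathbb N$ and all $\varepsilon\in(0,1/2)$ $$c_{r,1}^{\,d}\left(\frac d\varepsilon\right)^{d/r}\ \le\ n(\varepsilon,d,r)\ \le\ c_{r,2}^{\,d}\left(\frac d\varepsilon\right)^{d/r}.$$ Moreover, with the same constants, the lower bound $$c_{r,1}^{\,d}\left(\frac d\varepsilon\right)^{d/r}\le n(\varepsilon,D,r)$$ holds for every $d\in\mathbb N$, every open set $D\subset\mathbb R^d$ of Lebesgue measure $1$ and every $\varepsilon\in(0,1/2)$, and the upper bound $$n(\varepsilon,d,r)\le c_{r,2}^{\,d}\left(\frac d\varepsilon\right)^{d/r}$$ holds for every $d\in\mathbb N$ and every $\varepsilon\in(0,1)$. -/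

import Mathlib

open MeasureTheory
open scoped ENNReal

namespace IntegrationComplexity

noncomputable section

/-- The closed unit cube `[0,1]^d` in `ℝ^d`. -/
def cube (d : ℕ) : Set (Fin d → ℝ) := Set.Icc 0 1

/-- The `j`-th first-order partial derivative of `f` relative to the set `D`
(one-sided at boundary points of `D` that belong to `D`). -/
def partialDeriv {d : ℕ} (D : Set (Fin d → ℝ)) (j : Fin d) (f : (Fin d → ℝ) → ℝ) :
    (Fin d → ℝ) → ℝ :=
  fun x => fderivWithin ℝ f D x (Pi.single j 1)

/-- The partial derivative `D^β f = ∂₁^{β₁} ⋯ ∂_d^{β_d} f` for a multi-index `β`,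
relative to the set `D`. -/
def multiDeriv {d : ℕ} (D : Set (Fin d → ℝ)) (β : Fin d → ℕ) (f : (Fin d → ℝ) → ℝ) :
    (Fin d → ℝ) → ℝ :=
  (List.finRange d).foldr (fun j g => (partialDeriv D j)^[β j] g) f

/-- The unit ball of `C^r(D)`: functions that are `r` times continuously differentiable on `D`
with `|D^β f| ≤ 1` on `D` for every multi-index `β` with `|β|₁ ≤ r`.
Only the values of `f` on `D` matter. -/
def unitBall {d : ℕ} (D : Set (Fin d → ℝ)) (r : ℕ) : Set ((Fin d → ℝ) → ℝ) :=
  {f | ContDiffOn ℝ r f D ∧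
    ∀ β : Fin d → ℕ, ∑ j, β j ≤ r → ∀ x ∈ D, |multiDeriv D β f x| ≤ 1}

/-- The integration functional `S(f) = ∫_D f(x) dx`. -/
def integral {d : ℕ} (D : Set (Fin d → ℝ)) (f : (Fin d → ℝ) → ℝ) : ℝ := ∫ x in D, f x

/-- A deterministic, adaptive, possibly nonlinear algorithm that samples functions on `D`:
`point` chooses the next sample point in `D` from the list of the function values computed
so far, and `output` is an arbitrary map from the computed function values to the result. -/
structure Algorithm {d : ℕ} (D : Set (Fin d → ℝ)) where
  /-- The next sample point, given the values already computed. -/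
  point : List ℝ → D
  /-- The result, given all computed values. -/
  output : List ℝ → ℝ

namespace Algorithm

variable {d : ℕ} {D : Set (Fin d → ℝ)}

/-- The first `n` function values `f(x₁), …, f(xₙ)` that the algorithm computes, in order. -/
def values (A : Algorithm D) (f : (Fin d → ℝ) → ℝ) : ℕ → List ℝ
  | 0 => []
  | n + 1 => A.values f n ++ [f (A.point (A.values f n))]

/-- The result `A_n(f) = φ(f(x₁), …, f(xₙ))` after exactly `n` function values. -/
def result (A : Algorithm D) (n : ℕ) (f : (Fin d → ℝ) → ℝ) : ℝ := A.output (A.values f n)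

/-- The worst case error, over the unit ball of `C^r(D)`, of the algorithm with `n`
function values. -/
def error (A : Algorithm D) (r n : ℕ) : ℝ≥0∞ :=
  ⨆ f ∈ unitBall D r, ENNReal.ofReal |integral D f - A.result n f|

end Algorithm

/-- The `n`-th minimal worst case error of integration over `D` for the unit ball of `C^r(D)`. -/
def minimalError {d : ℕ} (D : Set (Fin d → ℝ)) (r n : ℕ) : ℝ≥0∞ :=
  ⨅ A : Algorithm D, A.error r n

/-- The information complexity `n(ε, D, r) = min {n : e_n ≤ ε}` (`⊤` if there is no such `n`). -/
def infoComplexity {d : ℕ} (ε : ℝ) (D : Set (Fin d → ℝ)) (r : ℕ) : ℕ∞ :=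
  ⨅ (n : ℕ) (_ : minimalError D r n ≤ ENNReal.ofReal ε), (n : ℕ∞)

end

end IntegrationComplexity

/-! Upper bound. A positive rule exact up to degree `r - 1`, copied to `m` equal cells of `[0,1]`,
has error at most `2 / m ^ r` by Taylor's formula (`exists_composite_quadrature`). Nonnegative
weights of sum one average errors instead of amplifying them, so coordinates contribute additively
and the `d`-fold product rule errs by at most `2 d / m ^ r`; only pure derivatives along coordinate
lines enter. Taking `m` of order `(2 d / ε) ^ (1 / r)` gives `(m N) ^ d` nodes.

Lower bound. Run an algorithm on the zero function and let `P` be its sample points. If `f` vanishes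
on `P`, then `f` and `-f` yield the same data, so the error is at least `|S(f)|` for one of them. To
build such an `f` (`exists_fooling_function`), take a cutoff `g` in the `ℓ¹`-distance, zero near `P`
and one far away, with a ramp of width `d δ`: a step `δ` along an axis changes `g` by at most `1 /
d`. Averaging `r` times over cubes of side `δ` creates `r` derivatives. The first costs the change
per step divided by `δ`, each later one a factor `2 / δ`; hence `2 ε g` becomes a member of the unit
ball when `(δ / 2) ^ r = ε / d`. The result equals `2 ε` outside `ℓ¹`-balls of radius `(2 r + 1) d
δ` around `P`. Such a ball has volume `(2 R) ^ d / d! ≤ (2 e R / d) ^ d`, so the factor `d` in the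
radius is absorbed, and few points leave volume at least `3 / 4` of `D` uncovered. About `D` only
measurability, volume one and unique differentiability matter, so the cube and open sets are treated
together. -/

/-! ### Positive quadrature in one variable -/

/-- In a finite-dimensional space, the convex hull of a compact set is compact. -/
theorem isCompact_convexHull_of_finiteDimensional {E : Type*} [NormedAddCommGroup E]
    [NormedSpace ℝ E] [FiniteDimensional ℝ E] {s : Set E} (hs : IsCompact s) :
    IsCompact (convexHull ℝ s) := by
  rcases s.eq_empty_or_nonempty with rfl | ⟨x₀, hx₀⟩
  · simp
  -- By Carathéodory, `finrank + 1` points always suffice, so the hull is a continuous image of a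
  -- compact product.
  set n := Module.finrank ℝ E + 1
  let φ : (Fin n → ℝ) × (Fin n → E) → E := fun p => ∑ i, p.1 i • p.2 i
  have hφ : Continuous φ := by fun_prop
  have hK : IsCompact (stdSimplex ℝ (Fin n) ×ˢ (Set.univ.pi fun _ : Fin n => s)) :=
    (isCompact_stdSimplex ℝ (Fin n)).prod (isCompact_univ_pi fun _ => hs)
  convert hK.image hφ using 1
  ext y
  constructor
  · intro hy
    obtain ⟨ι, _, z, w, hz, hind, hw, hw1, hy⟩ := eq_pos_convex_span_of_mem_convexHull hy
    have hcard : Fintype.card ι ≤ Fintype.card (Fin n) := by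
      have h1 := hind.card_le_finrank_succ
      have h2 := Submodule.finrank_le (vectorSpan ℝ (Set.range z))
      simp only [Fintype.card_fin]
      omega
    obtain ⟨e⟩ := Function.Embedding.nonempty_of_card_le hcard
    -- A combination of fewer points is padded with weight `0` at the dummy point `x₀`.
    refine ⟨(Function.extend e w 0, Function.extend e z fun _ => x₀), ⟨⟨?_, ?_⟩, ?_⟩, ?_⟩
    · intro i
      by_cases h : ∃ a, e a = i
      · obtain ⟨a, rfl⟩ := h
        simpa [e.injective.extend_apply] using (hw a).le
      · simp [Function.extend_apply' _ _ _ h]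
    · rw [← hw1]
      symm
      apply Fintype.sum_of_injective e e.injective
      · intro i hi
        simp [Function.extend_apply' _ _ _ (show ¬ ∃ a, e a = i by simpa using hi)]
      · intro a
        simp [e.injective.extend_apply]
    · intro i _
      by_cases h : ∃ a, e a = i
      · obtain ⟨a, rfl⟩ := h
        simpa [e.injective.extend_apply] using hz (Set.mem_range_self a)
      · simpa [Function.extend_apply' _ _ _ h] using hx₀
    · rw [← hy]
      symm
      apply Fintype.sum_of_injective e e.injective
      · intro i hi
        simp [Function.extend_apply' _ _ _ (show ¬ ∃ a, e a = i by simpa using hi)]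
      · intro a
        simp [e.injective.extend_apply]
  · rintro ⟨⟨w, z⟩, ⟨⟨hw, hw1⟩, hz⟩, rfl⟩
    exact (convex_convexHull ℝ s).sum_mem (fun i _ => hw i) hw1
      fun i _ => subset_convexHull ℝ s (hz i (Set.mem_univ i))

/-- For every `r` there is a quadrature rule on `[0,1]` with nonnegative weights that integrates
the monomials `1, t, …, t ^ r` exactly. -/
theorem exists_positive_quadrature (r : ℕ) :
    ∃ (ι : Type) (_ : Fintype ι) (w z : ι → ℝ), (∀ i, 0 ≤ w i) ∧ ∑ i, w i = 1 ∧
      (∀ i, z i ∈ Set.Icc (0 : ℝ) 1) ∧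
      ∀ k ≤ r, ∑ i, w i * z i ^ k = ∫ t in (0 : ℝ)..1, t ^ k := by
  let γ : ℝ → Fin (r + 1) → ℝ := fun t k => t ^ (k : ℕ)
  have hγ : Continuous γ := by fun_prop
  have hK : IsCompact (γ '' Set.Icc 0 1) := isCompact_Icc.image hγ
  have hint : IntegrableOn γ (Set.Icc (0 : ℝ) 1) := hγ.continuousOn.integrableOn_Icc
  have : IsProbabilityMeasure ((volume : Measure ℝ).restrict (Set.Icc 0 1)) :=
    ⟨by simp⟩
  -- The mean of the moment curve lies in the closed convex hull of the curve; writing it as a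
  -- convex combination of points of the curve gives the nodes and weights.
  have hmem : (∫ t in Set.Icc (0 : ℝ) 1, γ t) ∈ convexHull ℝ (γ '' Set.Icc 0 1) := by
    refine (convex_convexHull ℝ _).integral_mem
      (isCompact_convexHull_of_finiteDimensional hK).isClosed ?_ hint
    filter_upwards [ae_restrict_mem measurableSet_Icc] with t ht
    exact subset_convexHull ℝ _ ⟨t, ht, rfl⟩
  obtain ⟨ι, _, w, y, hw, hw1, hy, hsum⟩ := mem_convexHull_iff_exists_fintype.1 hmem
  choose z hz hzy using hy
  refine ⟨ι, inferInstance, w, z, hw, hw1, hz, fun k hk => ?_⟩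
  have h := congrFun hsum ⟨k, by omega⟩
  rw [eval_integral (f := γ) fun i => (by fun_prop : Continuous fun t => γ t i).integrableOn_Icc,
    integral_Icc_eq_integral_Ioc, ← intervalIntegral.integral_of_le zero_le_one] at h
  rw [← h, Finset.sum_apply]
  simp [← hzy, γ]

/-- A rule exact on polynomials of degree at most `n`, transported to `[a, a + h]`, has error
at most `2 h ^ (n + 2)` for functions whose derivative of order `n + 1` is bounded by `1`. -/
theorem abs_integral_sub_quadrature_le {n : ℕ} {ι : Type} [Fintype ι] {w z : ι → ℝ}
    (hw : ∀ i, 0 ≤ w i) (hw1 : ∑ i, w i = 1) (hz : ∀ i, z i ∈ Set.Icc (0 : ℝ) 1)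
    (hex : ∀ k ≤ n, ∑ i, w i * z i ^ k = ∫ t in (0 : ℝ)..1, t ^ k) {a h : ℝ} (hh : 0 < h)
    {f : ℝ → ℝ} (hf : ContDiffOn ℝ (n + 1) f (Set.Icc a (a + h)))
    (hb : ∀ y ∈ Set.Icc a (a + h), |iteratedDerivWithin (n + 1) f (Set.Icc a (a + h)) y| ≤ 1) :
    |(∫ x in a..(a + h), f x) - h * ∑ i, w i * f (a + h * z i)| ≤ 2 * h ^ (n + 2) := by
  -- `p` is the Taylor polynomial of `f` at `a` in the rescaled variable `t`. The rule is exact on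
  -- `p`, so the remainder enters twice, under the integral and under the weights: this is the
  -- factor `2`.
  set c : ℕ → ℝ := fun k =>
    (k.factorial : ℝ)⁻¹ * h ^ k * iteratedDerivWithin k f (Set.Icc a (a + h)) a
  set p : ℝ → ℝ := fun t => ∑ k ∈ Finset.range (n + 1), c k * t ^ k
  have hp : Continuous p := by fun_prop
  have hmaps : ∀ t ∈ Set.Icc (0 : ℝ) 1, a + h * t ∈ Set.Icc a (a + h) := fun t ht =>
    ⟨by nlinarith [ht.1], by nlinarith [ht.2]⟩
  have hR : ∀ t ∈ Set.Icc (0 : ℝ) 1, |f (a + h * t) - p t| ≤ h ^ (n + 1) := by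
    intro t ht
    have key := taylor_mean_remainder_bound (f := f) (n := n) (by linarith : a ≤ a + h) hf
      (hmaps t ht) hb
    have hpt : taylorWithinEval f n (Set.Icc a (a + h)) a (a + h * t) = p t := by
      rw [taylor_within_apply]
      refine Finset.sum_congr rfl fun k _ => ?_
      simp only [c, smul_eq_mul, add_sub_cancel_left, mul_pow]
      ring
    rw [hpt, Real.norm_eq_abs, add_sub_cancel_left] at key
    refine key.trans ?_
    rw [one_mul]
    calc (h * t) ^ (n + 1) / (n.factorial : ℝ) ≤ (h * t) ^ (n + 1) :=
          div_le_self (by have := ht.1; positivity) (by exact_mod_cast n.factorial_pos)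
      _ ≤ h ^ (n + 1) := by
          have := ht.1
          gcongr
          nlinarith [ht.2]
  have hcont : ContinuousOn (fun t => f (a + h * t)) (Set.Icc 0 1) :=
    hf.continuousOn.comp (by fun_prop) hmaps
  have hi : IntervalIntegrable (fun t => f (a + h * t)) volume 0 1 :=
    ContinuousOn.intervalIntegrable (by rwa [Set.uIcc_of_le zero_le_one])
  have hpe : ∑ i, w i * p (z i) = ∫ t in (0 : ℝ)..1, p t := by
    simp only [p]
    rw [intervalIntegral.integral_finsetSum fun k _ =>
      (by fun_prop : Continuous fun t : ℝ => c k * t ^ k).intervalIntegrable _ _]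
    simp only [Finset.mul_sum]
    rw [Finset.sum_comm]
    refine Finset.sum_congr rfl fun k hk => ?_
    rw [intervalIntegral.integral_const_mul, ← hex k (by simpa [Nat.lt_succ_iff] using hk),
      Finset.mul_sum]
    exact Finset.sum_congr rfl fun i _ => by ring
  have hcv : ∫ x in a..(a + h), f x = h * ∫ t in (0 : ℝ)..1, f (a + h * t) := by
    have := intervalIntegral.smul_integral_comp_add_mul (a := 0) (b := 1) f h a
    simp only [smul_eq_mul, mul_zero, add_zero, mul_one] at this
    exact this.symm
  have h1 : |∫ t in (0 : ℝ)..1, (f (a + h * t) - p t)| ≤ h ^ (n + 1) := by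
    have := intervalIntegral.norm_integral_le_of_norm_le_const (a := (0 : ℝ)) (b := 1)
      (f := fun t => f (a + h * t) - p t) (C := h ^ (n + 1)) fun t ht => by
        rw [Set.uIoc_of_le zero_le_one] at ht
        exact hR t ⟨ht.1.le, ht.2⟩
    simp only [Real.norm_eq_abs, sub_zero, abs_one, mul_one] at this
    exact this
  have h2 : |∑ i, w i * (f (a + h * z i) - p (z i))| ≤ h ^ (n + 1) := by
    calc |∑ i, w i * (f (a + h * z i) - p (z i))|
        ≤ ∑ i, |w i * (f (a + h * z i) - p (z i))| := Finset.abs_sum_le_sum_abs _ _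
      _ ≤ ∑ i, w i * h ^ (n + 1) := Finset.sum_le_sum fun i _ => by
          rw [abs_mul, abs_of_nonneg (hw i)]
          exact mul_le_mul_of_nonneg_left (hR _ (hz i)) (hw i)
      _ = h ^ (n + 1) := by rw [← Finset.sum_mul, hw1, one_mul]
  have hsplit : (∫ x in a..(a + h), f x) - h * ∑ i, w i * f (a + h * z i) =
      h * ((∫ t in (0 : ℝ)..1, (f (a + h * t) - p t)) -
        ∑ i, w i * (f (a + h * z i) - p (z i))) := by
    rw [hcv, intervalIntegral.integral_sub hi (hp.intervalIntegrable _ _), ← hpe]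
    simp only [mul_sub, Finset.sum_sub_distrib]
    ring
  rw [hsplit, abs_mul, abs_of_pos hh]
  calc h * |_| ≤ h * (h ^ (n + 1) + h ^ (n + 1)) := by
        gcongr
        exact (abs_sub _ _).trans (add_le_add h1 h2)
    _ = 2 * h ^ (n + 2) := by ring

/-- Composite rules: there is `N` such that for every `m ≥ 1` some positive rule with `m * N`
nodes integrates functions on `[0,1]` with `r`-th derivative bounded by `1` with error
at most `2 / m ^ r`. -/
theorem exists_composite_quadrature (r : ℕ) (hr : 1 ≤ r) :
    ∃ N : ℕ, 1 ≤ N ∧ ∀ m : ℕ, 1 ≤ m → ∃ (κ : Type) (_ : Fintype κ) (w z : κ → ℝ),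
      Fintype.card κ = m * N ∧ (∀ i, 0 ≤ w i) ∧ ∑ i, w i = 1 ∧
      (∀ i, z i ∈ Set.Icc (0 : ℝ) 1) ∧
      ∀ f : ℝ → ℝ, ContDiffOn ℝ r f (Set.Icc 0 1) →
        (∀ y ∈ Set.Icc (0 : ℝ) 1, |iteratedDerivWithin r f (Set.Icc 0 1) y| ≤ 1) →
        |(∫ t in Set.Icc (0 : ℝ) 1, f t) - ∑ i, w i * f (z i)| ≤ 2 / (m : ℝ) ^ r := by
  obtain ⟨n, rfl⟩ : ∃ n, r = n + 1 := ⟨r - 1, by omega⟩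
  obtain ⟨ι, _, w, z, hw, hw1, hz, hex⟩ := exists_positive_quadrature n
  refine ⟨Fintype.card ι, ?_, fun m hm => ?_⟩
  · by_contra h
    have : IsEmpty ι := Fintype.card_eq_zero_iff.1 (by omega)
    simp at hw1
  have hm0 : (0 : ℝ) < m := by exact_mod_cast hm
  have hcell : ∀ i : ℕ, i < m → Set.Icc ((i : ℝ) / m) (i / m + 1 / m) ⊆ Set.Icc 0 1 := by
    intro i hi x hx
    have hi' : (i : ℝ) + 1 ≤ m := by exact_mod_cast hi
    refine ⟨le_trans (by positivity) hx.1, hx.2.trans ?_⟩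
    rw [← add_div, div_le_one hm0]
    exact hi'
  refine ⟨Fin m × ι, inferInstance, fun p => w p.2 / m, fun p => (p.1 : ℕ) / m + 1 / m * z p.2,
    by simp, fun p => div_nonneg (hw _) hm0.le, ?_, ?_, ?_⟩
  · simp only [Fintype.sum_prod_type, ← Finset.sum_div, hw1]
    simp [hm0.ne']
  · intro p
    apply hcell p.1 p.1.2
    have hm1 : (0 : ℝ) < 1 / m := by positivity
    exact ⟨by nlinarith [(hz p.2).1], by nlinarith [(hz p.2).2]⟩
  intro f hf hb
  have hsum : ∫ t in Set.Icc (0 : ℝ) 1, f t =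
      ∑ i ∈ Finset.range m, ∫ t in ((i : ℝ) / m)..(i / m + 1 / m), f t := by
    have := intervalIntegral.sum_integral_adjacent_intervals (f := f) (μ := volume)
      (a := fun i : ℕ => (i : ℝ) / m) (n := m) fun k hk => by
        apply ContinuousOn.intervalIntegrable
        rw [Set.uIcc_of_le (by gcongr; simp)]
        refine hf.continuousOn.mono ?_
        have := hcell k hk
        rw [← add_div] at this
        exact_mod_cast this
    rw [integral_Icc_eq_integral_Ioc, ← intervalIntegral.integral_of_le zero_le_one]
    simp only [Nat.cast_zero, zero_div, div_self hm0.ne'] at this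
    rw [← this]
    refine Finset.sum_congr rfl fun i _ => ?_
    push_cast
    rw [add_div]
  rw [hsum, Fintype.sum_prod_type, ← Fin.sum_univ_eq_sum_range
    (fun i : ℕ => ∫ t in ((i : ℝ) / m)..(i / m + 1 / m), f t), ← Finset.sum_sub_distrib]
  -- There are `m` cells of length `1 / m`, each with error at most `2 / m ^ (r + 1)`, where `r = n
  -- + 1`.
  calc |∑ i : Fin m, ((∫ t in ((i : ℕ) / m : ℝ)..((i : ℕ) / m + 1 / m), f t) -
          ∑ j, w j / m * f ((i : ℕ) / m + 1 / m * z j))|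
      ≤ ∑ i : Fin m, |(∫ t in ((i : ℕ) / m : ℝ)..((i : ℕ) / m + 1 / m), f t) -
          ∑ j, w j / m * f ((i : ℕ) / m + 1 / m * z j)| := Finset.abs_sum_le_sum_abs _ _
    _ ≤ ∑ i : Fin m, 2 * (1 / (m : ℝ)) ^ (n + 2) := Finset.sum_le_sum fun i _ => by
        have hsub := hcell i i.2
        have hlt : ((i : ℕ) : ℝ) / m < (i : ℕ) / m + 1 / m := by
          have : (0 : ℝ) < 1 / m := by positivity
          linarith
        have := abs_integral_sub_quadrature_le hw hw1 hz hex (a := ((i : ℕ) : ℝ) / m)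
          (h := 1 / m) (by positivity) (f := f) (by exact_mod_cast hf.mono hsub) fun y hy => by
            have h2 : iteratedDerivWithin (n + 1) f (Set.Icc ((i : ℕ) / m : ℝ)
                ((i : ℕ) / m + 1 / m)) y = iteratedDerivWithin (n + 1) f (Set.Icc 0 1) y := by
              simp only [iteratedDerivWithin]
              rw [iteratedFDerivWithin_subset hsub (uniqueDiffOn_Icc hlt)
                (uniqueDiffOn_Icc zero_lt_one) (by exact_mod_cast hf) hy]
            rw [h2]
            exact hb y (hsub hy)
        rw [Finset.mul_sum] at this
        simpa only [mul_comm_div, div_mul_eq_mul_div, mul_div_assoc', one_mul] using this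
    _ = 2 / (m : ℝ) ^ (n + 1) := by
        simp only [Finset.sum_const, Finset.card_univ, Fintype.card_fin, nsmul_eq_mul,
          one_div, inv_pow]
        field_simp
        ring

/-! ### Tensor product rules -/

namespace IntegrationComplexity

/-- Tensor product of a positive quadrature rule: if the rule has error at most `η` along every
line parallel to a coordinate axis, then the product rule has error at most `d * η`. -/
theorem abs_integral_cube_sub_tensor_quadrature_le {κ : Type} [Fintype κ] {w z : κ → ℝ}
    (hw : ∀ i, 0 ≤ w i) (hw1 : ∑ i, w i = 1) (hz : ∀ i, z i ∈ Set.Icc (0 : ℝ) 1) {η : ℝ} :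
    ∀ (d : ℕ) (f : (Fin d → ℝ) → ℝ), ContinuousOn f (cube d) →
      (∀ x ∈ cube d, ∀ j, |(∫ t in Set.Icc (0 : ℝ) 1, f (Function.update x j t)) -
        ∑ i, w i * f (Function.update x j (z i))| ≤ η) →
      |(∫ x in cube d, f x) - ∑ s : Fin d → κ, (∏ j, w (s j)) * f (fun j => z (s j))| ≤ d * η := by
  intro d
  induction d with
  | zero =>
    intro f _ _
    have : cube 0 = Set.univ := by
      ext x; simp [cube, Set.mem_Icc]
    have hvol : (volume (Set.univ : Set (Fin 0 → ℝ))).toReal = 1 := by simp [volume_pi]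
    rw [this, Measure.restrict_univ]
    simp only [integral_unique, Measure.real, hvol, Finset.univ_unique, Finset.sum_singleton,
      Finset.univ_eq_empty, Finset.prod_empty, one_mul, one_smul, Nat.cast_zero, zero_mul]
    rw [Subsingleton.elim (fun j => z ((default : Fin 0 → κ) j)) default]
    exact (abs_nonpos_iff.2 (sub_eq_zero.2 (congrArg f (Subsingleton.elim _ _))))
  | succ d ih =>
    intro f hf hη
    have hcons : ∀ t ∈ Set.Icc (0 : ℝ) 1, ∀ y ∈ cube d, (Fin.cons t y : Fin (d + 1) → ℝ) ∈
        cube (d + 1) := by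
      intro t ht y hy
      refine ⟨fun j => ?_, fun j => ?_⟩
      · refine Fin.cases ?_ (fun i => ?_) j
        · simpa using ht.1
        · simpa using hy.1 i
      · refine Fin.cases ?_ (fun i => ?_) j
        · simpa using ht.2
        · simpa using hy.2 i
    have hK : IsCompact (Set.Icc (0 : ℝ) 1 ×ˢ cube d) := isCompact_Icc.prod isCompact_Icc
    have hcc : Continuous fun p : ℝ × (Fin d → ℝ) => (Fin.cons p.1 p.2 : Fin (d + 1) → ℝ) :=
      continuous_pi fun j => by
        refine Fin.cases ?_ (fun i => ?_) j
        · simpa using continuous_fst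
        · simp only [Fin.cons_succ]
          fun_prop
    have hfc : ContinuousOn (fun p : ℝ × (Fin d → ℝ) => f (Fin.cons p.1 p.2))
        (Set.Icc (0 : ℝ) 1 ×ˢ cube d) :=
      hf.comp hcc.continuousOn fun p hp => hcons _ hp.1 _ hp.2
    have hint : IntegrableOn (fun p : ℝ × (Fin d → ℝ) => f (Fin.cons p.1 p.2))
        (Set.Icc (0 : ℝ) 1 ×ˢ cube d) (volume.prod volume) := hfc.integrableOn_compact hK
    have hfub : ∫ x in cube (d + 1), f x =
        ∫ t in Set.Icc (0 : ℝ) 1, ∫ y in cube d, f (Fin.cons t y) := by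
      have mp := (volume_preserving_piFinSuccAbove (fun _ : Fin (d + 1) => ℝ) 0).symm
      have hpre : (MeasurableEquiv.piFinSuccAbove (fun _ : Fin (d + 1) => ℝ) 0).symm ⁻¹'
          cube (d + 1) = Set.Icc (0 : ℝ) 1 ×ˢ cube d := by
        ext ⟨t, y⟩
        simp [cube, MeasurableEquiv.piFinSuccAbove, Pi.le_def, Fin.forall_fin_succ]
      have he : ∀ p, (MeasurableEquiv.piFinSuccAbove (fun _ : Fin (d + 1) => ℝ) 0).symm p =
          Fin.cons p.1 p.2 := fun p => by
        simp [MeasurableEquiv.piFinSuccAbove]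
        rfl
      rw [← mp.setIntegral_preimage_emb (MeasurableEquiv.measurableEmbedding _), hpre,
        Measure.volume_eq_prod, ← setIntegral_prod _ hint]
      simp only [he]
    set W : (Fin d → κ) → ℝ := fun s => ∏ j, w (s j)
    set Z : (Fin d → κ) → Fin d → ℝ := fun s j => z (s j)
    have hW : ∀ s, 0 ≤ W s := fun s => Finset.prod_nonneg fun j _ => hw _
    have hW1 : ∑ s, W s = 1 := by
      have := Finset.prod_univ_sum (fun _ : Fin d => (Finset.univ : Finset κ)) (fun _ i => w i)
      simp only [hw1, Finset.prod_const_one, Fintype.piFinset_univ] at this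
      exact this.symm
    have hZ : ∀ s, Z s ∈ cube d := fun s => ⟨fun j => (hz _).1, fun j => (hz _).2⟩
    have hG : IntegrableOn (fun t => ∫ y in cube d, f (Fin.cons t y)) (Set.Icc (0 : ℝ) 1) := by
      have h := hint
      rw [IntegrableOn, ← Measure.prod_restrict] at h
      exact h.integral_prod_left
    have hline : ∀ s, ContinuousOn (fun t => f (Fin.cons t (Z s))) (Set.Icc (0 : ℝ) 1) := fun s =>
      hfc.comp (f := fun t : ℝ => (t, Z s)) (by fun_prop) fun t ht => ⟨ht, hZ s⟩
    have hlint : ∀ s, IntegrableOn (fun t => W s * f (Fin.cons t (Z s))) (Set.Icc (0 : ℝ) 1) :=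
      fun s => ((hline s).integrableOn_Icc).const_mul _
    have hsum : ∑ s : Fin (d + 1) → κ, (∏ j, w (s j)) * f (fun j => z (s j)) =
        ∑ s, W s * ∑ i, w i * f (Fin.cons (z i) (Z s)) := by
      rw [← (Fin.consEquiv fun _ : Fin (d + 1) => κ).sum_comp, Fintype.sum_prod_type,
        Finset.sum_comm]
      refine Finset.sum_congr rfl fun s _ => ?_
      rw [Finset.mul_sum]
      refine Finset.sum_congr rfl fun i _ => ?_
      simp only [Fin.consEquiv, Equiv.coe_fn_mk, Fin.prod_univ_succ, Fin.cons_zero, Fin.cons_succ]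
      have : (fun j => z ((Fin.cons i s : Fin (d + 1) → κ) j)) = Fin.cons (z i) (Z s) := by
        funext j
        refine Fin.cases ?_ (fun k => ?_) j <;> simp [Z]
      rw [this]
      ring
    -- First the last `d` variables are discretized under the outer integral, then the first
    -- variable at each node. Both errors are averaged with total mass one, so they add up to `d * η
    -- + η`.
    have hsplit : (∫ x in cube (d + 1), f x) -
        ∑ s : Fin (d + 1) → κ, (∏ j, w (s j)) * f (fun j => z (s j)) =
        (∫ t in Set.Icc (0 : ℝ) 1, ((∫ y in cube d, f (Fin.cons t y)) -
          ∑ s, W s * f (Fin.cons t (Z s)))) +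
        ∑ s, W s * ((∫ t in Set.Icc (0 : ℝ) 1, f (Fin.cons t (Z s))) -
          ∑ i, w i * f (Fin.cons (z i) (Z s))) := by
      rw [hfub, hsum, integral_sub hG (integrable_finsetSum _ fun s _ => hlint s),
        integral_finsetSum _ fun s _ => hlint s]
      simp only [integral_const_mul, mul_sub, Finset.sum_sub_distrib]
      ring
    have h1 : |∫ t in Set.Icc (0 : ℝ) 1, ((∫ y in cube d, f (Fin.cons t y)) -
        ∑ s, W s * f (Fin.cons t (Z s)))| ≤ d * η := by
      have := norm_setIntegral_le_of_norm_le_const (μ := volume) (s := Set.Icc (0 : ℝ) 1)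
        (f := fun t => (∫ y in cube d, f (Fin.cons t y)) - ∑ s, W s * f (Fin.cons t (Z s)))
        (C := d * η) (by simp) fun t ht => by
          refine ih (fun y => f (Fin.cons t y)) (hfc.comp (f := fun y => (t, y)) (by fun_prop)
            fun y hy => ⟨ht, hy⟩) fun x hx j => ?_
          have := hη (Fin.cons t x) (hcons t ht x hx) j.succ
          simpa only [Fin.cons_update] using this
      simpa [Real.norm_eq_abs] using this
    have h2 : |∑ s, W s * ((∫ t in Set.Icc (0 : ℝ) 1, f (Fin.cons t (Z s))) -
        ∑ i, w i * f (Fin.cons (z i) (Z s)))| ≤ η := by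
      calc _ ≤ ∑ s, |W s * ((∫ t in Set.Icc (0 : ℝ) 1, f (Fin.cons t (Z s))) -
            ∑ i, w i * f (Fin.cons (z i) (Z s)))| := Finset.abs_sum_le_sum_abs _ _
        _ ≤ ∑ s, W s * η := Finset.sum_le_sum fun s _ => by
            rw [abs_mul, abs_of_nonneg (hW s)]
            refine mul_le_mul_of_nonneg_left ?_ (hW s)
            have := hη (Fin.cons 0 (Z s)) (hcons 0 (by simp) _ (hZ s)) 0
            simpa only [Fin.update_cons_zero] using this
        _ = η := by rw [← Finset.sum_mul, hW1, one_mul]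
    rw [hsplit]
    refine (abs_add_le _ _).trans ((add_le_add h1 h2).trans_eq ?_)
    push_cast
    ring

/-! ### Linear rules as algorithms, and restriction to coordinate lines -/

/-- Every linear rule with nodes in `D` is realized by a (nonadaptive) algorithm. -/
theorem exists_algorithm_eq_sum {d : ℕ} {D : Set (Fin d → ℝ)} (p₀ : D) {κ : Type} [Fintype κ]
    (w : κ → ℝ) (p : κ → D) :
    ∃ A : Algorithm D, ∀ f, A.result (Fintype.card κ) f = ∑ i, w i * f (p i) := by
  classical
  set n := Fintype.card κ with hn
  let e : κ ≃ Fin n := Fintype.equivFin κ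
  let A : Algorithm D :=
    -- `p₀` only fills in for queries after the first `n`, which do not affect the result.
    { point := fun l => if h : l.length < n then p (e.symm ⟨l.length, h⟩) else p₀
      output := fun l => ∑ i, w i * l.getD (e i) 0 }
  refine ⟨A, fun f => ?_⟩
  have hlen : ∀ k, (A.values f k).length = k := by
    intro k
    induction k with
    | zero => rfl
    | succ k ih => simp [Algorithm.values, ih]
  have hval : ∀ k, ∀ i : Fin n, (i : ℕ) < k →
      (A.values f k).getD i 0 = f (p (e.symm i)) := by
    intro k
    induction k with
    | zero => intro i hi; omega
    | succ k ih =>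
      intro i hi
      simp only [Algorithm.values]
      rcases Nat.lt_succ_iff_lt_or_eq.1 hi with h | h
      · rw [List.getD_append _ _ _ _ (by rw [hlen]; exact h), ih i h]
      · rw [List.getD_append_right _ _ _ _ (by rw [hlen]; omega), hlen, h]
        have hk : k < n := h ▸ i.2
        have hpt : A.point (A.values f k) = p (e.symm i) := by
          simp only [A] at hlen ⊢
          rw [dif_pos (by rw [hlen]; exact hk)]
          congr 2
          exact Fin.ext ((hlen k).trans h.symm)
        rw [hpt, Nat.sub_self, List.getD_cons_zero]
  simp only [Algorithm.result, A]
  refine Finset.sum_congr rfl fun i _ => ?_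
  rw [hval n (e i) (e i).2, Equiv.symm_apply_apply]

theorem uniqueDiffOn_cube (d : ℕ) : UniqueDiffOn ℝ (cube d) := by
  have : cube d = Set.univ.pi fun _ => Set.Icc (0 : ℝ) 1 := by
    simp [cube, Set.pi_univ_Icc]
    rfl
  rw [this]
  exact UniqueDiffOn.univ_pi fun _ => uniqueDiffOn_Icc zero_lt_one

/-- Links the bounds defining `unitBall` to pure derivatives, the only ones that the product rule
needs. -/
theorem multiDeriv_single {d : ℕ} (D : Set (Fin d → ℝ)) (j : Fin d) (r : ℕ)
    (f : (Fin d → ℝ) → ℝ) :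
    multiDeriv D (Pi.single j r) f = (partialDeriv D j)^[r] f := by
  have key : ∀ l : List (Fin d), l.Nodup →
      l.foldr (fun i g => (partialDeriv D i)^[(Pi.single j r : Fin d → ℕ) i] g) f =
        if j ∈ l then (partialDeriv D j)^[r] f else f := by
    intro l
    induction l with
    | nil => simp
    | cons i l ih =>
      intro hl
      rw [List.nodup_cons] at hl
      rw [List.foldr_cons, ih hl.2]
      by_cases h : i = j
      · subst h
        simp [hl.1]
      · simp [Ne.symm h]
  rw [multiDeriv, key _ (List.nodup_finRange d), if_pos (List.mem_finRange j)]

theorem contDiffOn_iterate_partialDeriv {d r : ℕ} {D : Set (Fin d → ℝ)} (hD : UniqueDiffOn ℝ D)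
    {f : (Fin d → ℝ) → ℝ} (hf : ContDiffOn ℝ r f D) (j : Fin d) (k : ℕ) (hk : k ≤ r) :
    ContDiffOn ℝ (r - k : ℕ) ((partialDeriv D j)^[k] f) D := by
  induction k with
  | zero => simpa using hf
  | succ k ih =>
    rw [Function.iterate_succ_apply']
    have h := (ih (by omega)).fderivWithin (m := (r - (k + 1) : ℕ)) hD (by
      norm_cast
      omega)
    exact h.clm_apply contDiffOn_const

theorem update_mem_cube {d : ℕ} {x : Fin d → ℝ} (hx : x ∈ cube d) (j : Fin d) {t : ℝ}
    (ht : t ∈ Set.Icc (0 : ℝ) 1) : Function.update x j t ∈ cube d := by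
  refine ⟨fun i => ?_, fun i => ?_⟩ <;> rcases eq_or_ne i j with rfl | h
  · simpa using ht.1
  · simpa [h] using hx.1 i
  · simpa using ht.2
  · simpa [h] using hx.2 i

theorem iteratedDerivWithin_line {d r : ℕ} {f : (Fin d → ℝ) → ℝ} (hf : ContDiffOn ℝ r f (cube d))
    {x : Fin d → ℝ} (hx : x ∈ cube d) (j : Fin d) (k : ℕ) (hk : k ≤ r) :
    ∀ t ∈ Set.Icc (0 : ℝ) 1,
      iteratedDerivWithin k (fun t => f (Function.update x j t)) (Set.Icc 0 1) t =
        (partialDeriv (cube d) j)^[k] f (Function.update x j t) := by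
  induction k with
  | zero => simp
  | succ k ih =>
    intro t ht
    rw [iteratedDerivWithin_succ, derivWithin_congr (ih (by omega)) (ih (by omega) t ht),
      Function.iterate_succ_apply']
    have hdiff : DifferentiableWithinAt ℝ ((partialDeriv (cube d) j)^[k] f) (cube d)
        (Function.update x j t) :=
      ((contDiffOn_iterate_partialDeriv (uniqueDiffOn_cube d) hf j k (by omega)).differentiableOn
        (by norm_cast; omega)) _ (update_mem_cube hx j ht)
    have hd : HasDerivWithinAt (Function.update x j) (Pi.single j 1) (Set.Icc 0 1) t :=
      (hasDerivAt_update x j t).hasDerivWithinAt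
    exact (hdiff.hasFDerivWithinAt.comp_hasDerivWithinAt t hd fun s hs =>
      update_mem_cube hx j hs).derivWithin (uniqueDiffOn_Icc zero_lt_one t ht)

theorem contDiffOn_line {d r : ℕ} {f : (Fin d → ℝ) → ℝ} (hf : ContDiffOn ℝ r f (cube d))
    {x : Fin d → ℝ} (hx : x ∈ cube d) (j : Fin d) :
    ContDiffOn ℝ r (fun t => f (Function.update x j t)) (Set.Icc 0 1) :=
  hf.comp (contDiff_update _ x j).contDiffOn fun _ ht => update_mem_cube hx j ht

/-! ### The upper bound -/

/-- Product rules: upper bound for the information complexity of integration over the cube. -/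
theorem exists_infoComplexity_cube_le (r : ℕ) (hr : 1 ≤ r) :
    ∃ c : ℝ, 0 < c ∧ ∀ d : ℕ, 1 ≤ d → ∀ ε : ℝ, 0 < ε → ε < 1 →
      (infoComplexity ε (cube d) r : ℝ≥0∞) ≤
        ENNReal.ofReal (c ^ d * ((d : ℝ) / ε) ^ ((d : ℝ) / (r : ℝ))) := by
  obtain ⟨N, hN, hrule⟩ := exists_composite_quadrature r hr
  have hN0 : (1 : ℝ) ≤ N := by exact_mod_cast hN
  -- One factor `2` pays for rounding `y ≥ 1` up to `m`, the other for `2 ^ (1 / r) ≤ 2`.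
  refine ⟨4 * N, by positivity, fun d hd ε hε hε1 => ?_⟩
  have hr0 : (0 : ℝ) < r := by exact_mod_cast hr
  have hd1 : (1 : ℝ) ≤ d := by exact_mod_cast hd
  have hq : 1 ≤ (d : ℝ) / ε := by rw [le_div_iff₀ hε]; linarith
  -- Chosen so that `m ≥ y` forces `d * (2 / m ^ r) ≤ ε`.
  set y : ℝ := (2 * (d / ε)) ^ (1 / (r : ℝ)) with hy
  have hy1 : 1 ≤ y := Real.one_le_rpow (by linarith) (by positivity)
  have hyr : y ^ r = 2 * (d / ε) := by
    rw [hy, ← Real.rpow_natCast, ← Real.rpow_mul (by positivity), one_div_mul_cancel hr0.ne',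
      Real.rpow_one]
  set m := ⌈y⌉₊
  have hm1 : 1 ≤ m := Nat.one_le_ceil_iff.2 (by linarith)
  have hym : y ≤ m := Nat.le_ceil y
  have hmy : (m : ℝ) ≤ 2 * y := by linarith [Nat.ceil_lt_add_one (by linarith : 0 ≤ y)]
  obtain ⟨κ, _, w, z, hcard, hw, hw1, hz, herr⟩ := hrule m hm1
  have hzc : ∀ s : Fin d → κ, (fun j => z (s j)) ∈ cube d := fun s =>
    ⟨fun j => (hz _).1, fun j => (hz _).2⟩
  obtain ⟨A, hA⟩ := exists_algorithm_eq_sum (D := cube d) ⟨0, by simp [cube]⟩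
    (fun s : Fin d → κ => ∏ j, w (s j)) fun s => ⟨_, hzc s⟩
  set n := Fintype.card (Fin d → κ) with hn
  have hnm : (n : ℝ) = (m * N) ^ d := by
    rw [hn, Fintype.card_fun, hcard]
    simp
  have herror : A.error r n ≤ ENNReal.ofReal ε := by
    refine iSup₂_le fun f hf => ENNReal.ofReal_le_ofReal ?_
    rw [hA]
    refine (abs_integral_cube_sub_tensor_quadrature_le hw hw1 hz d f hf.1.continuousOn
      fun x hx j => herr _ (contDiffOn_line hf.1 hx j) fun t ht => ?_).trans ?_
    · rw [iteratedDerivWithin_line hf.1 hx j r le_rfl t ht, ← multiDeriv_single]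
      exact hf.2 _ (by simp) _ (update_mem_cube hx j ht)
    · have hmr : 2 * (d / ε) ≤ (m : ℝ) ^ r := hyr ▸ by gcongr
      rw [mul_div_assoc', div_le_iff₀ (by positivity)]
      calc (d : ℝ) * 2 = ε * (2 * (d / ε)) := by field_simp
        _ ≤ _ := by gcongr
  have hinfo : infoComplexity ε (cube d) r ≤ n :=
    iInf₂_le (f := fun (n : ℕ) (_ : minimalError (cube d) r n ≤ ENNReal.ofReal ε) => (n : ℕ∞)) n
      ((iInf_le _ A).trans herror)
  have hbound : (n : ℝ) ≤ (4 * N) ^ d * ((d : ℝ) / ε) ^ ((d : ℝ) / (r : ℝ)) := by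
    have hy2 : y ≤ 2 * (d / ε) ^ (1 / (r : ℝ)) := by
      rw [hy, Real.mul_rpow (by norm_num) (by positivity)]
      gcongr
      calc (2 : ℝ) ^ (1 / (r : ℝ)) ≤ 2 ^ (1 : ℝ) := by
            gcongr
            · norm_num
            · rw [div_le_one hr0]; exact_mod_cast hr
        _ = 2 := Real.rpow_one 2
    have hexp : ((d : ℝ) / ε) ^ ((d : ℝ) / (r : ℝ)) = ((d / ε) ^ (1 / (r : ℝ))) ^ d := by
      rw [← Real.rpow_natCast, ← Real.rpow_mul (by positivity)]
      congr 1
      ring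
    rw [hnm, hexp, ← mul_pow]
    refine pow_le_pow_left₀ (by positivity) ?_ d
    calc (m : ℝ) * N ≤ (2 * (2 * (d / ε) ^ (1 / (r : ℝ)))) * N := by
          gcongr
          linarith
      _ = _ := by ring
  calc (infoComplexity ε (cube d) r : ℝ≥0∞) ≤ ((n : ℕ∞) : ℝ≥0∞) := by exact_mod_cast hinfo
    _ = ENNReal.ofReal n := by simp
    _ ≤ _ := ENNReal.ofReal_le_ofReal hbound

/-! ### Smoothing by means over segments and cubes -/

/-- `G` is the partial derivative of `F` in direction `j`, everywhere. -/
def HasPartialDeriv {d : ℕ} (j : Fin d) (F G : (Fin d → ℝ) → ℝ) : Prop :=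
  ∀ x s, HasDerivAt (fun t => F (x + (Pi.single j t : Fin d → ℝ))) (G (x + (Pi.single j s : Fin d → ℝ))) s

/-- The mean of `g` over the segment of length `δ` in direction `i`. -/
noncomputable def axisMean {d : ℕ} (δ : ℝ) (i : Fin d) (g : (Fin d → ℝ) → ℝ) (x : Fin d → ℝ) : ℝ :=
  ∫ t in (0 : ℝ)..1, g (x + (Pi.single i (δ * t) : Fin d → ℝ))

/-- Successive means along the axes in the list `l`. -/
noncomputable def listMean {d : ℕ} (δ : ℝ) (l : List (Fin d)) (g : (Fin d → ℝ) → ℝ) :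
    (Fin d → ℝ) → ℝ :=
  l.foldr (axisMean δ) g

variable {d : ℕ} {δ : ℝ}

theorem continuous_axis (i : Fin d) : Continuous fun t : ℝ => (Pi.single i t : Fin d → ℝ) :=
  _root_.continuous_single (A := fun _ : Fin d => ℝ) i

theorem continuous_shift_single {g : (Fin d → ℝ) → ℝ} (hg : Continuous g) (x : Fin d → ℝ)
    (i : Fin d) (δ : ℝ) : Continuous fun t : ℝ => g (x + (Pi.single i (δ * t) : Fin d → ℝ)) :=
  hg.comp (continuous_const.add ((continuous_axis i).comp (by fun_prop)))

theorem continuous_axisMean {g : (Fin d → ℝ) → ℝ} (hg : Continuous g) (i : Fin d) :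
    Continuous (axisMean δ i g) := by
  refine intervalIntegral.continuous_parametric_intervalIntegral_of_continuous'
    (f := fun x t => g (x + (Pi.single i (δ * t) : Fin d → ℝ))) ?_ 0 1
  exact hg.comp (continuous_fst.add ((continuous_axis i).comp (by fun_prop)))

theorem axisMean_mem_Icc {g : (Fin d → ℝ) → ℝ} (hg : Continuous g) (i : Fin d) {x : Fin d → ℝ}
    {a b : ℝ} (h : ∀ t ∈ Set.Icc (0 : ℝ) 1, g (x + (Pi.single i (δ * t) : Fin d → ℝ)) ∈ Set.Icc a b) :
    axisMean δ i g x ∈ Set.Icc a b := by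
  have hi := (continuous_shift_single hg x i δ).intervalIntegrable (μ := volume) 0 1
  constructor
  · have := intervalIntegral.integral_mono_on zero_le_one
      ((continuous_const (y := a)).intervalIntegrable (μ := volume) 0 1) hi fun t ht => (h t ht).1
    simp only [intervalIntegral.integral_const, sub_zero, one_smul] at this
    exact this
  · have := intervalIntegral.integral_mono_on zero_le_one hi
      ((continuous_const (y := b)).intervalIntegrable (μ := volume) 0 1) fun t ht => (h t ht).2
    simp only [intervalIntegral.integral_const, sub_zero, one_smul] at this
    exact this

theorem abs_axisMean_add_sub_le {g : (Fin d → ℝ) → ℝ} (hg : Continuous g) (i : Fin d)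
    {v : Fin d → ℝ} {M : ℝ} (h : ∀ x, |g (x + v) - g x| ≤ M) (x : Fin d → ℝ) :
    |axisMean δ i g (x + v) - axisMean δ i g x| ≤ M := by
  simp only [axisMean]
  rw [← intervalIntegral.integral_sub
    ((continuous_shift_single hg _ i δ).intervalIntegrable _ _)
    ((continuous_shift_single hg _ i δ).intervalIntegrable _ _)]
  have := intervalIntegral.norm_integral_le_of_norm_le_const (a := (0 : ℝ)) (b := 1)
    (f := fun t => g (x + v + (Pi.single i (δ * t) : Fin d → ℝ)) - g (x + (Pi.single i (δ * t) : Fin d → ℝ))) (C := M)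
    fun t _ => by
      rw [Real.norm_eq_abs, add_right_comm]
      exact h _
  rw [sub_zero, abs_one, mul_one] at this
  exact this

/-- By the fundamental theorem of calculus, a moving average has a difference quotient as its
derivative. A derivative is thus gained from mere continuity. -/
theorem hasPartialDeriv_axisMean_self {g : (Fin d → ℝ) → ℝ} (hg : Continuous g) (i : Fin d)
    (hδ : δ ≠ 0) :
    HasPartialDeriv i (axisMean δ i g) fun x => (g (x + (Pi.single i δ : Fin d → ℝ)) - g x) / δ := by
  intro x s
  set φ : ℝ → ℝ := fun u => g (x + (Pi.single i u : Fin d → ℝ)) with hφ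
  have hφc : Continuous φ := hg.comp (continuous_const.add (continuous_axis i))
  have hΦ : ∀ u, HasDerivAt (fun u => ∫ y in (0 : ℝ)..u, φ y) (φ u) u := fun u =>
    intervalIntegral.integral_hasDerivAt_right (hφc.intervalIntegrable _ _)
      (hφc.stronglyMeasurableAtFilter _ _) hφc.continuousAt
  have hfun : (fun t => axisMean δ i g (x + (Pi.single i t : Fin d → ℝ))) =
      fun t => ((∫ y in (0 : ℝ)..(t + δ), φ y) - ∫ y in (0 : ℝ)..t, φ y) / δ := by
    funext t
    rw [intervalIntegral.integral_interval_sub_left (hφc.intervalIntegrable _ _)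
      (hφc.intervalIntegrable _ _)]
    have h := intervalIntegral.integral_comp_add_mul (a := 0) (b := 1) φ hδ t
    simp only [mul_zero, add_zero, mul_one, smul_eq_mul] at h
    rw [div_eq_inv_mul, ← h]
    simp only [axisMean, hφ, Pi.single_add, add_assoc]
  rw [hfun]
  have h1 : HasDerivAt (fun t => ∫ y in (0 : ℝ)..(t + δ), φ y) (φ (s + δ)) s :=
    (hΦ (s + δ)).comp_add_const s δ
  have hval : (g (x + (Pi.single i s : Fin d → ℝ) + (Pi.single i δ : Fin d → ℝ)) -
      g (x + (Pi.single i s : Fin d → ℝ))) / δ = (φ (s + δ) - φ s) / δ := by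
    simp only [hφ, Pi.single_add, add_assoc]
  refine HasDerivAt.congr_deriv ?_ hval.symm
  exact (h1.sub (hΦ s)).div_const δ

theorem HasPartialDeriv.axisMean {g G : (Fin d → ℝ) → ℝ} {j : Fin d} (h : HasPartialDeriv j g G)
    (hg : Continuous g) (hG : Continuous G) {C : ℝ} (hC : ∀ x, |G x| ≤ C) (i : Fin d) :
    HasPartialDeriv j (axisMean δ i g) (axisMean δ i G) := by
  intro x s
  refine (intervalIntegral.hasDerivAt_integral_of_dominated_loc_of_deriv_le
    (F := fun s t => g (x + (Pi.single j s : Fin d → ℝ) + (Pi.single i (δ * t) : Fin d → ℝ)))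
    (F' := fun s t => G (x + (Pi.single j s : Fin d → ℝ) + (Pi.single i (δ * t) : Fin d → ℝ))) (bound := fun _ => C)
    (s := Set.univ) Filter.univ_mem
    (Filter.Eventually.of_forall fun s =>
      (continuous_shift_single hg _ i δ).aestronglyMeasurable)
    ((continuous_shift_single hg _ i δ).intervalIntegrable _ _)
    (continuous_shift_single hG _ i δ).aestronglyMeasurable
    (Filter.Eventually.of_forall fun t _ s _ => hC _)
    (continuous_const.intervalIntegrable _ _)
    (Filter.Eventually.of_forall fun t _ s _ => ?_)).2
  have := h (x + (Pi.single i (δ * t) : Fin d → ℝ)) s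
  simpa only [add_right_comm] using this

theorem continuous_listMean {g : (Fin d → ℝ) → ℝ} (hg : Continuous g) (l : List (Fin d)) :
    Continuous (listMean δ l g) := by
  induction l with
  | nil => exact hg
  | cons i l ih => exact continuous_axisMean ih i

/-- Each mean looks at most `δ` away in the `ℓ¹`-norm. This locality later yields the sup bound, the
zeros on `P` and the plateau alike. -/
theorem listMean_mem_Icc {g : (Fin d → ℝ) → ℝ} (hg : Continuous g) (hδ : 0 ≤ δ) {a b : ℝ}
    (l : List (Fin d)) (x : Fin d → ℝ)
    (h : ∀ y, ∑ k, |y k - x k| ≤ δ * l.length → g y ∈ Set.Icc a b) :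
    listMean δ l g x ∈ Set.Icc a b := by
  induction l generalizing x with
  | nil => exact h x (by simp)
  | cons i l ih =>
    refine axisMean_mem_Icc (continuous_listMean hg l) i fun t ht => ih _ fun y hy => h y ?_
    have h1 : ∀ k, |y k - x k| ≤ |y k - (x + (Pi.single i (δ * t) : Fin d → ℝ)) k| +
        |(Pi.single i (δ * t) : Fin d → ℝ) k| := fun k => by
      refine le_of_eq_of_le ?_ (abs_add_le _ _)
      rw [Pi.add_apply, sub_add_eq_sub_sub, sub_add_cancel]
    have h2 : ∑ k, |(Pi.single i (δ * t) : Fin d → ℝ) k| ≤ δ := by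
      rw [Finset.sum_eq_single i (fun k _ hk => by simp [Pi.single_eq_of_ne hk]) (by simp),
        Pi.single_eq_same, abs_of_nonneg (mul_nonneg hδ ht.1)]
      nlinarith [ht.2]
    calc ∑ k, |y k - x k| ≤ _ := Finset.sum_le_sum fun k _ => h1 k
      _ ≤ δ * l.length + δ := by
          rw [Finset.sum_add_distrib]
          exact add_le_add hy h2
      _ = δ * (i :: l).length := by
          rw [List.length_cons]
          push_cast
          ring

theorem abs_listMean_le {g : (Fin d → ℝ) → ℝ} (hg : Continuous g) (hδ : 0 ≤ δ) {M : ℝ}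
    (h : ∀ x, |g x| ≤ M) (l : List (Fin d)) (x : Fin d → ℝ) : |listMean δ l g x| ≤ M :=
  abs_le.2 (listMean_mem_Icc hg hδ l x fun y _ => abs_le.1 (h y))

theorem abs_listMean_add_sub_le {g : (Fin d → ℝ) → ℝ} (hg : Continuous g)
    {v : Fin d → ℝ} {M : ℝ} (h : ∀ x, |g (x + v) - g x| ≤ M) (l : List (Fin d))
    (x : Fin d → ℝ) : |listMean δ l g (x + v) - listMean δ l g x| ≤ M := by
  induction l generalizing x with
  | nil => exact h x
  | cons i l ih => exact abs_axisMean_add_sub_le (continuous_listMean hg l) i ih x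

theorem HasPartialDeriv.listMean {g G : (Fin d → ℝ) → ℝ} {j : Fin d} (h : HasPartialDeriv j g G)
    (hg : Continuous g) (hG : Continuous G) (hδ : 0 ≤ δ) {C : ℝ} (hC : ∀ x, |G x| ≤ C)
    (l : List (Fin d)) : HasPartialDeriv j (listMean δ l g) (listMean δ l G) := by
  induction l with
  | nil => exact h
  | cons i l ih =>
    exact ih.axisMean (continuous_listMean hg l) (continuous_listMean hG l)
      (abs_listMean_le hG hδ hC l) i

/-- Averaging along a list of axes containing `j` creates a partial derivative in direction `j`. -/
theorem exists_hasPartialDeriv_listMean {g : (Fin d → ℝ) → ℝ} (hg : Continuous g) (hδ : 0 < δ)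
    {j : Fin d} {M : ℝ} (h : ∀ x, |g (x + (Pi.single j δ : Fin d → ℝ)) - g x| ≤ M) {l : List (Fin d)}
    (hj : j ∈ l) :
    ∃ G, Continuous G ∧ (∀ x, |G x| ≤ M / δ) ∧ HasPartialDeriv j (listMean δ l g) G := by
  induction l with
  | nil => simp at hj
  | cons i l ih =>
    have hc := continuous_listMean (δ := δ) hg l
    rcases eq_or_ne j i with rfl | hne
    · refine ⟨_, ?_, fun x => ?_, hasPartialDeriv_axisMean_self hc j hδ.ne'⟩
      · fun_prop
      · rw [abs_div, abs_of_pos hδ]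
        gcongr
        exact abs_listMean_add_sub_le hg h l x
    · obtain ⟨G, hG, hGM, hpd⟩ := ih ((List.mem_cons.1 hj).resolve_left hne)
      refine ⟨axisMean δ i G, continuous_axisMean hG i, fun x => ?_, hpd.axisMean hc hG hGM i⟩
      exact abs_le.2 (axisMean_mem_Icc hG i fun t _ => abs_le.1 (hGM _))

/-- The mean of `g` over a cube with side `δ`. -/
noncomputable def boxMean (δ : ℝ) (g : (Fin d → ℝ) → ℝ) : (Fin d → ℝ) → ℝ :=
  listMean δ (List.finRange d) g

theorem continuous_iterate_boxMean {g : (Fin d → ℝ) → ℝ} (hg : Continuous g) (k : ℕ) :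
    Continuous ((boxMean δ)^[k] g) := by
  induction k with
  | zero => exact hg
  | succ k ih =>
    rw [Function.iterate_succ_apply']
    exact continuous_listMean ih _

theorem iterate_boxMean_mem_Icc {g : (Fin d → ℝ) → ℝ} (hg : Continuous g) (hδ : 0 ≤ δ) {a b : ℝ}
    (k : ℕ) (x : Fin d → ℝ) (h : ∀ y, ∑ i, |y i - x i| ≤ k * (δ * d) → g y ∈ Set.Icc a b) :
    (boxMean δ)^[k] g x ∈ Set.Icc a b := by
  induction k generalizing x with
  | zero => exact h x (by simp)
  | succ k ih =>
    rw [Function.iterate_succ_apply']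
    refine listMean_mem_Icc (continuous_iterate_boxMean hg k) hδ _ x fun y hy => ih y
      fun z hz => h z ?_
    rw [List.length_finRange] at hy
    calc ∑ i, |z i - x i| ≤ ∑ i, (|z i - y i| + |y i - x i|) :=
          Finset.sum_le_sum fun i _ => abs_sub_le _ _ _
      _ ≤ k * (δ * d) + δ * d := by
          rw [Finset.sum_add_distrib]
          exact add_le_add hz hy
      _ = (k + 1 : ℕ) * (δ * d) := by
          push_cast
          ring

theorem abs_iterate_boxMean_le {g : (Fin d → ℝ) → ℝ} (hg : Continuous g) (hδ : 0 ≤ δ) {M : ℝ}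
    (h : ∀ x, |g x| ≤ M) (k : ℕ) (x : Fin d → ℝ) : |(boxMean δ)^[k] g x| ≤ M :=
  abs_le.2 (iterate_boxMean_mem_Icc hg hδ k x fun y _ => abs_le.1 (h y))

theorem HasPartialDeriv.iterate_boxMean {g G : (Fin d → ℝ) → ℝ} {j : Fin d}
    (h : HasPartialDeriv j g G) (hg : Continuous g) (hG : Continuous G) (hδ : 0 ≤ δ) {C : ℝ}
    (hC : ∀ x, |G x| ≤ C) (k : ℕ) :
    HasPartialDeriv j ((boxMean δ)^[k] g) ((boxMean δ)^[k] G) := by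
  induction k with
  | zero => exact h
  | succ k ih =>
    rw [Function.iterate_succ_apply', Function.iterate_succ_apply']
    exact ih.listMean (continuous_iterate_boxMean hg k) (continuous_iterate_boxMean hG k) hδ
      (abs_iterate_boxMean_le hG hδ hC k) _

/-! ### Bounds on iterated partial derivatives -/

/-- `F` has continuous iterated partial derivatives up to order `k`, all bounded by `C`. -/
def SmoothBounded (C : ℝ) : ℕ → ((Fin d → ℝ) → ℝ) → Prop
  | 0, F => Continuous F ∧ ∀ x, |F x| ≤ C
  | k + 1, F => (Continuous F ∧ ∀ x, |F x| ≤ C) ∧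
      ∀ j, ∃ G, HasPartialDeriv j F G ∧ SmoothBounded C k G

theorem SmoothBounded.base {C : ℝ} {k : ℕ} {F : (Fin d → ℝ) → ℝ} (h : SmoothBounded C k F) :
    Continuous F ∧ ∀ x, |F x| ≤ C := by
  cases k with
  | zero => exact h
  | succ k => exact h.1

theorem SmoothBounded.neg {C : ℝ} {k : ℕ} {F : (Fin d → ℝ) → ℝ} (h : SmoothBounded C k F) :
    SmoothBounded C k fun x => -F x := by
  induction k generalizing F with
  | zero => exact ⟨h.1.neg, fun x => by rw [abs_neg]; exact h.2 x⟩
  | succ k ih =>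
    refine ⟨⟨h.1.1.neg, fun x => by rw [abs_neg]; exact h.1.2 x⟩, fun j => ?_⟩
    obtain ⟨G, hG, hGs⟩ := h.2 j
    exact ⟨fun x => -G x, fun x s => (hG x s).neg, ih hGs⟩

/-- The innermost box mean supplies one derivative, a difference of two values divided by `δ`, at
the cost of a factor `2 / δ`; the remaining means commute with it. Since `2 / δ ≥ 1`, the bound for
the top order covers the lower orders. -/
theorem smoothBounded_iterate_boxMean {C M : ℝ} (hδ : 0 < δ) (hδ2 : δ ≤ 2) (k : ℕ)
    {g : (Fin d → ℝ) → ℝ} (hg : Continuous g) (hM : ∀ x, |g x| ≤ M) (hC : (2 / δ) ^ k * M ≤ C) :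
    SmoothBounded C k ((boxMean δ)^[k] g) := by
  have hM0 : 0 ≤ M := (abs_nonneg _).trans (hM 0)
  have h2 : 1 ≤ 2 / δ := by rwa [one_le_div hδ]
  have hMC : M ≤ C := le_trans (le_mul_of_one_le_left hM0 (one_le_pow₀ h2)) hC
  induction k generalizing g M with
  | zero => exact ⟨hg, fun x => (hM x).trans hMC⟩
  | succ k ih =>
    refine ⟨⟨continuous_iterate_boxMean hg _,
      fun x => (abs_iterate_boxMean_le hg hδ.le hM _ x).trans hMC⟩, fun j => ?_⟩
    obtain ⟨G, hG, hGM, hpd⟩ := exists_hasPartialDeriv_listMean (M := 2 * M) hg hδ (j := j)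
      (fun x => (abs_sub _ _).trans (by linarith [hM (x + (Pi.single j δ : Fin d → ℝ)), hM x]))
      (List.mem_finRange j)
    rw [Function.iterate_succ_apply]
    refine ⟨_, hpd.iterate_boxMean (continuous_listMean hg _) hG hδ.le hGM k, ?_⟩
    have hC' : (2 / δ) ^ k * (2 * M / δ) ≤ C := by
      refine le_of_eq_of_le ?_ hC
      ring
    exact ih hG hGM hC' (by positivity)
      (le_trans (le_mul_of_one_le_left (by positivity) (one_le_pow₀ h2)) hC')

/-- The first derivative is bounded through the change `M` per step rather than twice the supremum.
This refinement is what brings the dimension `d` into the lower bound. -/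
theorem smoothBounded_iterate_succ_boxMean {C M : ℝ} (hδ : 0 < δ) (hδ2 : δ ≤ 2) (k : ℕ)
    {g : (Fin d → ℝ) → ℝ} (hg : Continuous g) (hgC : ∀ x, |g x| ≤ C)
    (hM : ∀ j x, |g (x + (Pi.single j δ : Fin d → ℝ)) - g x| ≤ M) (hC : (2 / δ) ^ k * (M / δ) ≤ C) :
    SmoothBounded C (k + 1) ((boxMean δ)^[k + 1] g) := by
  refine ⟨⟨continuous_iterate_boxMean hg _, abs_iterate_boxMean_le hg hδ.le hgC _⟩, fun j => ?_⟩
  obtain ⟨G, hG, hGM, hpd⟩ := exists_hasPartialDeriv_listMean hg hδ (hM j) (List.mem_finRange j)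
  rw [Function.iterate_succ_apply]
  exact ⟨_, hpd.iterate_boxMean (continuous_listMean hg _) hG hδ.le hGM k,
    smoothBounded_iterate_boxMean hδ hδ2 k hG hGM hC⟩

/-- Move from `x` to `x + h` one coordinate at a time and apply the mean value inequality on each
segment; all intermediate points stay within sup-distance `‖h‖` of `x`. -/
theorem abs_sub_le_of_hasPartialDeriv {F : (Fin d → ℝ) → ℝ} {G : Fin d → (Fin d → ℝ) → ℝ}
    (hFG : ∀ j, HasPartialDeriv j F (G j)) {x h : Fin d → ℝ} {c : Fin d → ℝ} {η : ℝ}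
    (hG : ∀ j y, ‖y - x‖ ≤ ‖h‖ → |G j y - c j| ≤ η) :
    |F (x + h) - F x - ∑ j, c j * h j| ≤ η * ∑ j, |h j| := by
  classical
  have key : ∀ s : Finset (Fin d),
      |F (x + ∑ j ∈ s, (Pi.single j (h j) : Fin d → ℝ)) - F x - ∑ j ∈ s, c j * h j| ≤
        η * ∑ j ∈ s, |h j| := by
    intro s
    induction s using Finset.induction_on with
    | empty => simp
    | insert j s hj ih =>
      set y := x + ∑ i ∈ s, (Pi.single i (h i) : Fin d → ℝ) with hy
      have hyx : x + ∑ i ∈ insert j s, (Pi.single i (h i) : Fin d → ℝ) =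
          y + (Pi.single j (h j) : Fin d → ℝ) := by
        rw [Finset.sum_insert hj, hy]
        abel
      have hmem : ∀ t ∈ segment ℝ 0 (h j), ‖y + (Pi.single j t : Fin d → ℝ) - x‖ ≤ ‖h‖ := by
        intro t ht
        have ht' : |t| ≤ |h j| := by
          obtain ⟨a, b, ha, hb, hab, rfl⟩ := ht
          simp only [smul_eq_mul, mul_zero, zero_add, abs_mul, abs_of_nonneg hb]
          nlinarith [abs_nonneg (h j)]
        rw [pi_norm_le_iff_of_nonneg (norm_nonneg _)]
        intro i
        have hi : |h i| ≤ ‖h‖ := norm_le_pi_norm h i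
        simp only [hy, Pi.sub_apply, Pi.add_apply, Finset.sum_apply, Finset.sum_pi_single]
        rcases eq_or_ne i j with rfl | hne
        · simp only [hj, if_false, Pi.single_eq_same, add_zero, add_sub_cancel_left]
          exact ht'.trans hi
        · rw [Pi.single_eq_of_ne hne]
          split_ifs
          · simpa using hi
          · simp
      have hstep : |F (y + (Pi.single j (h j) : Fin d → ℝ)) - F y - c j * h j| ≤ η * |h j| := by
        have := (convex_segment (𝕜 := ℝ) (0 : ℝ) (h j)).norm_image_sub_le_of_norm_hasDerivWithin_le
          (f := fun t => F (y + (Pi.single j t : Fin d → ℝ)) - c j * t)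
          (f' := fun t => G j (y + (Pi.single j t : Fin d → ℝ)) - c j) (C := η)
          (x := 0) (y := h j)
          (fun t _ => by
            have := (hFG j y t).sub ((hasDerivAt_id t).const_mul (c j))
            rw [mul_one] at this
            exact this.hasDerivWithinAt)
          (fun t ht => hG j _ (hmem t ht)) (left_mem_segment ..) (right_mem_segment ..)
        simp only [Pi.single_zero, add_zero, mul_zero, sub_zero, Real.norm_eq_abs] at this
        rwa [sub_right_comm] at this
      rw [hyx, Finset.sum_insert hj, Finset.sum_insert hj, mul_add]
      calc |F (y + (Pi.single j (h j) : Fin d → ℝ)) - F x - (c j * h j + ∑ i ∈ s, c i * h i)|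
          = |(F (y + (Pi.single j (h j) : Fin d → ℝ)) - F y - c j * h j) +
              (F y - F x - ∑ i ∈ s, c i * h i)| := by congr 1; ring
        _ ≤ _ := (abs_add_le _ _).trans (add_le_add hstep ih)
  have := key Finset.univ
  rwa [Finset.univ_sum_single h] at this

/-- A function with continuous partial derivatives is differentiable. -/
theorem hasFDerivAt_of_hasPartialDeriv {F : (Fin d → ℝ) → ℝ} {G : Fin d → (Fin d → ℝ) → ℝ}
    (hFG : ∀ j, HasPartialDeriv j F (G j)) (hG : ∀ j, Continuous (G j)) (x : Fin d → ℝ) :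
    HasFDerivAt F (∑ j, G j x • (ContinuousLinearMap.proj j : (Fin d → ℝ) →L[ℝ] ℝ)) x := by
  rw [hasFDerivAt_iff_isLittleO_nhds_zero, Asymptotics.isLittleO_iff]
  intro ε hε
  -- The `ℓ¹`-norm of `h` is at most `d * ‖h‖`; the denominator `d + 1` avoids division by zero when
  -- `d = 0`.
  set η := ε / (d + 1) with hη
  have hη0 : 0 < η := by positivity
  have hev : ∀ᶠ y in nhds x, ∀ j, |G j y - G j x| ≤ η := by
    rw [Filter.eventually_all]
    intro j
    filter_upwards [Metric.continuousAt_iff'.1 (hG j).continuousAt η hη0] with y hy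
    exact hy.le
  obtain ⟨ρ, hρ, hball⟩ := Metric.eventually_nhds_iff_ball.1 hev
  filter_upwards [Metric.ball_mem_nhds 0 hρ] with h hh
  rw [mem_ball_zero_iff] at hh
  have := abs_sub_le_of_hasPartialDeriv hFG (x := x) (h := h) (c := fun j => G j x) (η := η)
    fun j y hy => hball y (mem_ball_iff_norm.2 (hy.trans_lt hh)) j
  simp only [sum_apply, smul_apply,
    ContinuousLinearMap.proj_apply, smul_eq_mul, Real.norm_eq_abs]
  refine this.trans ?_
  have hs : ∑ j, |h j| ≤ d * ‖h‖ := by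
    calc ∑ j, |h j| ≤ ∑ _j : Fin d, ‖h‖ := Finset.sum_le_sum fun j _ => norm_le_pi_norm h j
      _ = d * ‖h‖ := by simp
  calc η * ∑ j, |h j| ≤ η * (d * ‖h‖) := by gcongr
    _ ≤ η * ((d + 1) * ‖h‖) := by gcongr; linarith
    _ = ε * ‖h‖ := by rw [hη]; field_simp

theorem SmoothBounded.contDiff {C : ℝ} {k : ℕ} {F : (Fin d → ℝ) → ℝ} (h : SmoothBounded C k F) :
    ContDiff ℝ k F := by
  induction k generalizing F with
  | zero => exact contDiff_zero.2 h.1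
  | succ k ih =>
    choose G hFG hG using h.2
    have : ContDiff ℝ ((k : ℕ) + 1) F := contDiff_succ_iff_hasFDerivAt.2
      ⟨_, ContDiff.sum fun j _ => (ih (hG j)).smul contDiff_const,
        hasFDerivAt_of_hasPartialDeriv hFG fun j => (hG j).base.1⟩
    exact_mod_cast this

/-- Iterated derivatives relative to `D` are known only on `D`, hence the separate `H`, which agrees
with `F` there. Unique differentiability identifies its relative derivative with the global one of
`F`. -/
theorem SmoothBounded.partialDeriv {C : ℝ} {k : ℕ} {D : Set (Fin d → ℝ)} (hD : UniqueDiffOn ℝ D)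
    {F H : (Fin d → ℝ) → ℝ} (h : SmoothBounded C (k + 1) F) (hH : Set.EqOn H F D) (j : Fin d) :
    ∃ G, SmoothBounded C k G ∧ Set.EqOn (partialDeriv D j H) G D := by
  choose G hFG hG using h.2
  refine ⟨G j, hG j, fun x hx => ?_⟩
  have hfd := hasFDerivAt_of_hasPartialDeriv hFG (fun j => (hG j).base.1) x
  rw [IntegrationComplexity.partialDeriv, fderivWithin_congr hH (hH hx),
    hfd.hasFDerivWithinAt.fderivWithin (hD x hx)]
  simp [Pi.single_apply]

theorem SmoothBounded.iterate_partialDeriv {C : ℝ} {k : ℕ} {D : Set (Fin d → ℝ)}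
    (hD : UniqueDiffOn ℝ D) (j : Fin d) (m : ℕ) {F H : (Fin d → ℝ) → ℝ}
    (h : SmoothBounded C (k + m) F) (hH : Set.EqOn H F D) :
    ∃ G, SmoothBounded C k G ∧
      Set.EqOn ((IntegrationComplexity.partialDeriv D j)^[m] H) G D := by
  induction m generalizing F H with
  | zero => exact ⟨F, h, hH⟩
  | succ m ih =>
    obtain ⟨G, hG, hGe⟩ := SmoothBounded.partialDeriv (k := k + m) hD h hH j
    exact ih hG hGe

theorem SmoothBounded.mono {C : ℝ} {k m : ℕ} (hkm : k ≤ m) {F : (Fin d → ℝ) → ℝ}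
    (h : SmoothBounded C m F) : SmoothBounded C k F := by
  induction k generalizing F m with
  | zero => exact h.base
  | succ k ih =>
    obtain ⟨m, rfl⟩ : ∃ n, m = n + 1 := ⟨m - 1, by omega⟩
    refine ⟨h.base, fun j => ?_⟩
    obtain ⟨G, hG, hGs⟩ := h.2 j
    exact ⟨G, hG, ih (by omega) hGs⟩

theorem SmoothBounded.mem_unitBall {r : ℕ} {D : Set (Fin d → ℝ)} (hD : UniqueDiffOn ℝ D)
    {F : (Fin d → ℝ) → ℝ} (h : SmoothBounded 1 r F) : F ∈ unitBall D r := by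
  refine ⟨h.contDiff.contDiffOn, fun β hβ x hx => ?_⟩
  -- `k` counts the orders of smoothness left after the directions in `l` have been spent.
  have key : ∀ (l : List (Fin d)) (k : ℕ), SmoothBounded 1 (k + (l.map β).sum) F →
      ∃ G, SmoothBounded 1 k G ∧ Set.EqOn
        (l.foldr (fun j g => (IntegrationComplexity.partialDeriv D j)^[β j] g) F) G D := by
    intro l
    induction l with
    | nil => exact fun k hk => ⟨F, hk, fun _ _ => rfl⟩
    | cons i l ih =>
      intro k hk
      rw [List.map_cons, List.sum_cons, ← add_assoc] at hk
      obtain ⟨G, hG, hGe⟩ := ih (k + β i) hk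
      exact hG.iterate_partialDeriv hD i (β i) hGe
  have hsum : ((List.finRange d).map β).sum = ∑ j, β j := by
    rw [← List.ofFn_eq_map, List.sum_ofFn]
  obtain ⟨G, hG, hGe⟩ := key (List.finRange d) 0 (h.mono (by rw [hsum]; omega))
  rw [multiDeriv, hGe hx]
  exact hG.2 x

/-! ### Cutoffs and fooling functions -/

/-- A function with values in `[0,1]` that is Lipschitz for the `ℓ¹`-norm with constant `1 / L`,
vanishes within `ℓ¹`-distance `a` of `P` and equals `1` beyond `ℓ¹`-distance `a + L`. -/
theorem exists_cutoff (P : Finset (Fin d → ℝ)) {L : ℝ} (hL : 0 < L) (a : ℝ) :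
    ∃ g : (Fin d → ℝ) → ℝ, Continuous g ∧ (∀ x, g x ∈ Set.Icc (0 : ℝ) 1) ∧
      (∀ x y, |g x - g y| ≤ (∑ j, |x j - y j|) / L) ∧
      (∀ p ∈ P, ∀ x, ∑ j, |x j - p j| ≤ a → g x = 0) ∧
      ∀ x, (∀ p ∈ P, a + L ≤ ∑ j, |x j - p j|) → g x = 1 := by
  classical
  induction P using Finset.induction_on with
  | empty =>
    refine ⟨fun _ => 1, continuous_const, fun _ => by simp, fun x y => ?_, by simp, fun _ _ => rfl⟩
    rw [sub_self, abs_zero]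
    positivity
  | insert p P _ ih =>
    obtain ⟨g, hg, hg01, hgL, hg0, hg1⟩ := ih
    -- Each point contributes a truncated ramp in its `ℓ¹`-distance; minima preserve the Lipschitz
    -- constant, so it does not depend on the size of `P`.
    set φ : (Fin d → ℝ) → ℝ := fun x => max (((∑ j, |x j - p j|) - a) / L) 0 with hφ
    have hφL : ∀ x y, |φ x - φ y| ≤ (∑ j, |x j - y j|) / L := by
      intro x y
      refine (abs_max_sub_max_le_abs _ _ _).trans ?_
      rw [← sub_div, sub_sub_sub_cancel_right, ← Finset.sum_sub_distrib, abs_div, abs_of_pos hL]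
      gcongr
      refine (Finset.abs_sum_le_sum_abs _ _).trans (Finset.sum_le_sum fun j _ => ?_)
      refine (abs_abs_sub_abs_le_abs_sub _ _).trans_eq ?_
      rw [sub_sub_sub_cancel_right]
    refine ⟨fun x => min (g x) (φ x), hg.min (by fun_prop), fun x => ⟨?_, ?_⟩, fun x y => ?_,
      fun q hq x hx => ?_, fun x hx => ?_⟩
    · exact le_min (hg01 x).1 (le_max_right _ _)
    · exact (min_le_left _ _).trans (hg01 x).2
    · exact (abs_min_sub_min_le_max _ _ _ _).trans (max_le (hgL x y) (hφL x y))
    · rcases Finset.mem_insert.1 hq with rfl | hq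
      · have : φ x = 0 := max_eq_right (div_nonpos_of_nonpos_of_nonneg (by linarith) hL.le)
        simp only [this, min_eq_right (hg01 x).1]
      · have : (0 : ℝ) ≤ φ x := le_max_right _ _
        simp only [hg0 q hq x hx, min_eq_left this]
    · have h1 : 1 ≤ φ x := by
        refine le_max_of_le_left ?_
        rw [one_le_div hL]
        linarith [hx p (Finset.mem_insert_self _ _)]
      simp only [hg1 x fun q hq => hx q (Finset.mem_insert_of_mem hq), min_eq_left h1]

/-- The exact volume is `(2 R) ^ d / d!`, and `d ^ d / d! ≤ e ^ d`. -/
theorem volume_l1Ball_le (hd : 1 ≤ d) (p : Fin d → ℝ) {R : ℝ} (hR : 0 ≤ R) :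
    volume {x : Fin d → ℝ | ∑ j, |x j - p j| ≤ R} ≤
      ENNReal.ofReal ((2 * Real.exp 1 * R / d) ^ d) := by
  have : Nonempty (Fin d) := ⟨⟨0, hd⟩⟩
  have hd0 : (0 : ℝ) < d := by exact_mod_cast hd
  have htrans : volume {x : Fin d → ℝ | ∑ j, |x j - p j| ≤ R} =
      volume {x : Fin d → ℝ | (∑ j, |x j| ^ (1 : ℝ)) ^ (1 / (1 : ℝ)) ≤ R} := by
    rw [← measure_preimage_add_right volume p]
    simp
  rw [htrans, volume_sum_rpow_le _ le_rfl, Fintype.card_fin, ← ENNReal.ofReal_pow hR,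
    ← ENNReal.ofReal_mul (by positivity)]
  apply ENNReal.ofReal_le_ofReal
  have hG : Real.Gamma ((d : ℝ) / 1 + 1) = d.factorial := by
    rw [div_one, Real.Gamma_nat_eq_factorial]
  have hG2 : Real.Gamma (1 / 1 + 1) = 1 := by norm_num
  rw [hG, hG2, mul_one]
  have hfac : (d : ℝ) ^ d / d.factorial ≤ Real.exp 1 ^ d := by
    rw [← Real.exp_nat_mul, mul_one]
    exact Real.pow_div_factorial_le_exp _ hd0.le d
  have hf0 : (0 : ℝ) < d.factorial := by exact_mod_cast d.factorial_pos
  calc R ^ d * (2 ^ d / d.factorial) = (2 * R / d) ^ d * ((d : ℝ) ^ d / d.factorial) := by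
        rw [div_pow, mul_pow]
        field_simp
    _ ≤ (2 * R / d) ^ d * Real.exp 1 ^ d := by gcongr
    _ = _ := by rw [← mul_pow]; ring

/-- Fooling functions: if `P` has few points, some function in the unit ball of `C^r(D)` together
with its negative vanishes on `P` and has integral at least `3 / 2 * ε`. -/
theorem exists_fooling_function {r : ℕ} (hr : 1 ≤ r) (hd : 1 ≤ d) {D : Set (Fin d → ℝ)}
    (hD : UniqueDiffOn ℝ D) (hDm : MeasurableSet D) (hDv : volume D = 1) {ε : ℝ} (hε : 0 < ε)
    (hε2 : ε < 1 / 2) (P : Finset (Fin d → ℝ))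
    (hP : (P.card : ℝ) < (1 / (16 * Real.exp 1 * (2 * r + 1))) ^ d *
      ((d : ℝ) / ε) ^ ((d : ℝ) / (r : ℝ))) :
    ∃ f, f ∈ unitBall D r ∧ (fun x => -f x) ∈ unitBall D r ∧ (∀ p ∈ P, f p = 0) ∧
      3 / 2 * ε ≤ integral D f := by
  have hr0 : (0 : ℝ) < r := by exact_mod_cast hr
  have hd1 : (1 : ℝ) ≤ d := by exact_mod_cast hd
  have hd0 : (0 : ℝ) < d := by linarith
  set θ : ℝ := (ε / d) ^ (1 / (r : ℝ)) with hθ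
  have hθ0 : 0 < θ := by positivity
  have hθ1 : θ ≤ 1 := Real.rpow_le_one (by positivity)
    (by rw [div_le_one hd0]; linarith) (by positivity)
  have hθr : θ ^ r = ε / d := by
    rw [hθ, ← Real.rpow_natCast, ← Real.rpow_mul (by positivity), one_div_mul_cancel hr0.ne',
      Real.rpow_one]
  have hθd : ((d : ℝ) / ε) ^ ((d : ℝ) / (r : ℝ)) = (θ⁻¹) ^ d := by
    rw [hθ, ← Real.inv_rpow (by positivity), inv_div, ← Real.rpow_natCast,
      ← Real.rpow_mul (by positivity)]
    congr 1
    ring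
  -- With this choice `(2 / δ) ^ (r - 1) * (2 ε / d) / δ = θ⁻¹ ^ r * (ε / d) = 1`.
  set δ : ℝ := 2 * θ with hδ
  have hδ0 : 0 < δ := by positivity
  -- The `r` box means together reach `ℓ¹`-distance `r * (δ * d)`, so `g` has to vanish that far
  -- around `P` for the averaged function to vanish on `P`.
  obtain ⟨g, hg, hg01, hgL, hg0, hg1⟩ := exists_cutoff P (L := d * δ) (by positivity)
    (r * (δ * d))
  set G : (Fin d → ℝ) → ℝ := fun x => 2 * ε * g x with hG
  have hGc : Continuous G := by fun_prop
  have hG01 : ∀ x, G x ∈ Set.Icc 0 (2 * ε) := fun x =>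
    ⟨mul_nonneg (by positivity) (hg01 x).1,
      mul_le_of_le_one_right (by positivity) (hg01 x).2⟩
  set f : (Fin d → ℝ) → ℝ := (boxMean δ)^[r] G with hf
  have hsmooth : SmoothBounded 1 r f := by
    obtain ⟨k, rfl⟩ : ∃ k, r = k + 1 := ⟨r - 1, by omega⟩
    refine smoothBounded_iterate_succ_boxMean (M := 2 * ε / d) hδ0 (by linarith) k hGc
      (fun x => ?_) (fun j x => ?_) (le_of_eq ?_)
    · rw [abs_of_nonneg (hG01 x).1]
      linarith [(hG01 x).2]
    · rw [← mul_sub, abs_mul, abs_of_pos (by positivity : 0 < 2 * ε)]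
      have h1 := hgL (x + (Pi.single j δ : Fin d → ℝ)) x
      have h2 : ∑ i, |(x + (Pi.single j δ : Fin d → ℝ)) i - x i| = δ := by
        simp only [Pi.add_apply, add_sub_cancel_left]
        rw [Finset.sum_eq_single j (fun k _ hk => by simp [Pi.single_eq_of_ne hk]) (by simp),
          Pi.single_eq_same, abs_of_pos hδ0]
      rw [h2] at h1
      calc 2 * ε * |_| ≤ 2 * ε * (δ / (d * δ)) := by gcongr
        _ = 2 * ε / d := by field_simp
    · have h3 : 2 / δ = θ⁻¹ := by rw [hδ]; field_simp
      have h4 : 2 * ε / d / δ = θ ^ (k + 1) * θ⁻¹ := by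
        rw [hθr, hδ]
        field_simp
      rw [h3, h4, pow_succ, inv_pow]
      field_simp
  have hf0 : ∀ x, 0 ≤ f x := fun x =>
    (iterate_boxMean_mem_Icc hGc hδ0.le r x fun y _ => hG01 y).1
  -- Zero zone `r d δ`, ramp `d δ`, and again the reach `r d δ` of the means.
  set R : ℝ := (2 * r + 1) * (d * δ) with hR
  have hf2 : ∀ x, (∀ p ∈ P, R < ∑ j, |x j - p j|) → f x = 2 * ε := by
    intro x hx
    have := iterate_boxMean_mem_Icc (a := 2 * ε) (b := 2 * ε) hGc hδ0.le r x fun y hy => by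
      have : g y = 1 := hg1 y fun p hp => by
        have h1 : ∑ j, |x j - p j| ≤ ∑ j, |y j - x j| + ∑ j, |y j - p j| := by
          rw [← Finset.sum_add_distrib]
          refine Finset.sum_le_sum fun j _ => ?_
          rw [abs_sub_comm (y j) (x j)]
          exact abs_sub_le _ _ _
        have h2 := hx p hp
        rw [hR] at h2
        nlinarith
      simp [hG, this]
    exact le_antisymm this.2 this.1
  refine ⟨f, hsmooth.mem_unitBall hD, hsmooth.neg.mem_unitBall hD, fun p hp => ?_, ?_⟩
  · have := iterate_boxMean_mem_Icc (a := 0) (b := 0) hGc hδ0.le r p fun y hy => by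
      simp [hG, hg0 p hp y hy]
    exact le_antisymm this.2 this.1
  set B : (Fin d → ℝ) → Set (Fin d → ℝ) := fun p => {x | ∑ j, |x j - p j| ≤ R} with hB
  have hBm : ∀ p, MeasurableSet (B p) := fun p =>
    (isClosed_le (by fun_prop) continuous_const).measurableSet
  set U : Set (Fin d → ℝ) := ⋃ p ∈ P, B p with hU
  have hUm : MeasurableSet U := Finset.measurableSet_biUnion P fun p _ => hBm p
  have hUv : volume U ≤ ENNReal.ofReal (1 / 4) := by
    refine (measure_biUnion_finset_le P B).trans ?_
    refine (Finset.sum_le_sum fun p _ =>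
      volume_l1Ball_le hd p (by positivity : 0 ≤ R)).trans ?_
    rw [Finset.sum_const, nsmul_eq_mul, ← ENNReal.ofReal_natCast, ← ENNReal.ofReal_mul (by simp)]
    apply ENNReal.ofReal_le_ofReal
    rw [hθd, ← mul_pow] at hP
    -- Here `2 e R / d = 4 e (2 r + 1) θ`, so the constant `16` leaves exactly `(1 / 4) ^ d`.
    calc (P.card : ℝ) * (2 * Real.exp 1 * R / d) ^ d
        ≤ (1 / (16 * Real.exp 1 * (2 * r + 1)) * θ⁻¹) ^ d * (2 * Real.exp 1 * R / d) ^ d := by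
          gcongr
      _ = (1 / 4) ^ d := by
          rw [← mul_pow, hR, hδ]
          congr 1
          field_simp
          norm_num
      _ ≤ 1 / 4 := pow_le_of_le_one (by norm_num) (by norm_num) (by omega)
  have hfi : IntegrableOn f D := by
    refine Measure.integrableOn_of_bounded (M := 1) (by simp [hDv])
      hsmooth.base.1.aestronglyMeasurable (Filter.Eventually.of_forall hsmooth.base.2)
  have hE : 3 / 4 ≤ volume.real (D \ U) := by
    have h1 : volume.real D ≤ volume.real (D \ U) + volume.real U :=
      (measureReal_mono (by intro x hx; by_cases h : x ∈ U <;> simp [h, hx])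
        (measure_union_ne_top
          (measure_ne_top_of_subset Set.sdiff_subset (by simp [hDv]))
          (ne_top_of_le_ne_top ENNReal.ofReal_ne_top hUv))).trans (measureReal_union_le _ _)
    have h2 : volume.real U ≤ 1 / 4 :=
      ENNReal.toReal_le_of_le_ofReal (by norm_num) hUv
    have h3 : volume.real D = 1 := by simp [Measure.real, hDv]
    linarith
  have hEint : ∫ x in D \ U, f x = 2 * ε * volume.real (D \ U) := by
    rw [setIntegral_congr_fun (g := fun _ => 2 * ε) (hDm.diff hUm) fun x hx => hf2 x fun p hp => ?_]
    · rw [setIntegral_const, smul_eq_mul, mul_comm]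
    · by_contra hle
      exact hx.2 (Set.mem_biUnion hp (not_lt.1 hle))
  calc 3 / 2 * ε = 2 * ε * (3 / 4) := by ring
    _ ≤ 2 * ε * volume.real (D \ U) := by gcongr
    _ = ∫ x in D \ U, f x := hEint.symm
    _ ≤ ∫ x in D, f x := setIntegral_mono_set hfi (Filter.Eventually.of_forall hf0)
        Set.sdiff_subset.eventuallyLE

/-! ### The lower bound for adaptive algorithms -/

/-- Adaption does not help: as long as only zeros are seen, the next point is the one chosen for the
zero function. -/
theorem Algorithm.values_eq_of_vanish {D : Set (Fin d → ℝ)} (A : Algorithm D)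
    {f : (Fin d → ℝ) → ℝ} (n : ℕ) (h : ∀ k < n, f (A.point (A.values (fun _ => 0) k)) = 0) :
    A.values f n = A.values (fun _ => 0) n := by
  induction n with
  | zero => rfl
  | succ n ih =>
    simp only [Algorithm.values]
    rw [ih fun k hk => h k (by omega), h n (by omega)]

/-- Lower bound for the information complexity of integration over a set of volume `1`. -/
theorem le_infoComplexity {r : ℕ} (hr : 1 ≤ r) (hd : 1 ≤ d) {D : Set (Fin d → ℝ)}
    (hD : UniqueDiffOn ℝ D) (hDm : MeasurableSet D) (hDv : volume D = 1) {ε : ℝ} (hε : 0 < ε)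
    (hε2 : ε < 1 / 2) :
    ENNReal.ofReal ((1 / (16 * Real.exp 1 * (2 * r + 1))) ^ d *
      ((d : ℝ) / ε) ^ ((d : ℝ) / (r : ℝ))) ≤ (infoComplexity ε D r : ℝ≥0∞) := by
  classical
  set X : ℝ := (1 / (16 * Real.exp 1 * (2 * r + 1))) ^ d * ((d : ℝ) / ε) ^ ((d : ℝ) / (r : ℝ))
    with hX
  have hceil : ((⌈X⌉₊ : ℕ) : ℕ∞) ≤ infoComplexity ε D r := by
    refine le_iInf₂ fun n hn => ?_
    rw [Nat.cast_le, Nat.ceil_le]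
    by_contra! hlt
    -- The minimal error is an infimum, so a gap uniform in the algorithm is needed; `3 / 2 * ε`
    -- instead of `ε` provides it.
    have herror : ENNReal.ofReal (3 / 2 * ε) ≤ minimalError D r n := by
      refine le_iInf fun A => ?_
      set P : Finset (Fin d → ℝ) := (Finset.range n).image fun k =>
        (A.point (A.values (fun _ => 0) k) : Fin d → ℝ)
      have hPn : (P.card : ℝ) ≤ n := by
        exact_mod_cast Finset.card_image_le.trans_eq (Finset.card_range n)
      obtain ⟨f, hf, hfn, hfP, hfi⟩ :=
        exists_fooling_function hr hd hD hDm hDv hε hε2 P (hPn.trans_lt hlt)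
      have hz : ∀ k < n, f (A.point (A.values (fun _ => 0) k)) = 0 := fun k hk =>
        hfP _ (Finset.mem_image_of_mem _ (Finset.mem_range.2 hk))
      have hres : A.result n f = A.result n fun x => -f x := by
        simp only [Algorithm.result]
        rw [A.values_eq_of_vanish n hz,
          A.values_eq_of_vanish (f := fun x => -f x) n fun k hk => by simp only [hz k hk, neg_zero]]
      have hneg : integral D (fun x => -f x) = -integral D f := integral_neg f
      -- The common output is at most `0` or at least `0`, hence on the wrong side for `f` or for
      -- `-f`.
      have habs : integral D f ≤ |integral D f - A.result n f| ∨
          integral D f ≤ |integral D (fun x => -f x) - A.result n fun x => -f x| := by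
        rw [← hres, hneg]
        rcases le_total (A.result n f) 0 with h | h
        · exact Or.inl (le_trans (by linarith) (le_abs_self _))
        · refine Or.inr (le_trans ?_ (neg_le_abs _))
          linarith
      rcases habs with h | h
      · exact (ENNReal.ofReal_le_ofReal (hfi.trans h)).trans
          (le_iSup₂ (f := fun f (_ : f ∈ unitBall D r) =>
            ENNReal.ofReal |integral D f - A.result n f|) f hf)
      · exact (ENNReal.ofReal_le_ofReal (hfi.trans h)).trans
          (le_iSup₂ (f := fun f (_ : f ∈ unitBall D r) =>
            ENNReal.ofReal |integral D f - A.result n f|) _ hfn)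
    have := (ENNReal.ofReal_le_ofReal_iff hε.le).1 (herror.trans hn)
    linarith
  calc ENNReal.ofReal X ≤ ENNReal.ofReal (⌈X⌉₊ : ℕ) := ENNReal.ofReal_le_ofReal (Nat.le_ceil X)
    _ = (((⌈X⌉₊ : ℕ) : ℕ∞) : ℝ≥0∞) := by simp
    _ ≤ _ := by exact_mod_cast hceil

end IntegrationComplexity

theorem theorem1 (r : ℕ) (hr : 1 ≤ r) :
    ∃ c₁ c₂ : ℝ, 0 < c₁ ∧ 0 < c₂ ∧ ∀ d : ℕ, 1 ≤ d →
      (∀ ε : ℝ, 0 < ε → ε < 1 / 2 →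
        ENNReal.ofReal (c₁ ^ d * ((d : ℝ) / ε) ^ ((d : ℝ) / (r : ℝ)))
            ≤ (IntegrationComplexity.infoComplexity ε (IntegrationComplexity.cube d) r : ℝ≥0∞) ∧
          (IntegrationComplexity.infoComplexity ε (IntegrationComplexity.cube d) r : ℝ≥0∞)
            ≤ ENNReal.ofReal (c₂ ^ d * ((d : ℝ) / ε) ^ ((d : ℝ) / (r : ℝ)))) ∧
      (∀ D : Set (Fin d → ℝ), IsOpen D → volume D = 1 → ∀ ε : ℝ, 0 < ε → ε < 1 / 2 →
        ENNReal.ofReal (c₁ ^ d * ((d : ℝ) / ε) ^ ((d : ℝ) / (r : ℝ)))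
          ≤ (IntegrationComplexity.infoComplexity ε D r : ℝ≥0∞)) ∧
      (∀ ε : ℝ, 0 < ε → ε < 1 →
        (IntegrationComplexity.infoComplexity ε (IntegrationComplexity.cube d) r : ℝ≥0∞)
          ≤ ENNReal.ofReal (c₂ ^ d * ((d : ℝ) / ε) ^ ((d : ℝ) / (r : ℝ)))) := by

  obtain ⟨c, hc, hupper⟩ := IntegrationComplexity.exists_infoComplexity_cube_le r hr
  refine ⟨1 / (16 * Real.exp 1 * (2 * r + 1)), c, by positivity, hc, fun d hd =>
    ⟨fun ε hε hε2 => ⟨?_, hupper d hd ε hε (by linarith)⟩, fun D hD hDv ε hε hε2 =>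
      IntegrationComplexity.le_infoComplexity hr hd hD.uniqueDiffOn hD.measurableSet hDv hε hε2,
      hupper d hd⟩⟩
  refine IntegrationComplexity.le_infoComplexity hr hd
    (IntegrationComplexity.uniqueDiffOn_cube d) measurableSet_Icc ?_ hε hε2
  simp [IntegrationComplexity.cube, Real.volume_Icc_pi]
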